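/- For the generator $\mathcal L$ of a continuous-time reversible Markov chain on a finite state space, the spectral gap is the second smallest eigenvalue of $-\mathcal L$, counted with multiplicity (equivalently, the smallest eigenvalue of $-\mathcal L$ that has a non-constant eigenfunction; $+\infty$ for a one-point space), and the relaxation time is its inverse in $[0,\infty]$. For $n\ge 1$ and $1\le i_1<i_2<\dots<i_k\le n$ with $k\ge 1$, let $$\mathcal M^{(n)}_{[i_1,\dots,i_k]}=\{A\in\mathbb F_2^{n\times k}:\ A(i,j)=0 \text{ for } i>i_j,\ A(i_j,j)=1 \text{ for all } j\},$$ and let the matrix walk on these columns be the continuous-time Markov chain on this set with generator $$(\mathcal L f)(A)=\tfrac12\sum_{i=1}^{n-1}\sum_{a\in\mathbb F_2}\bigl[f((I+aE^{i,i+1})A)-f(A)\bigr],$$ where $E^{i,i+1}$ is the $n\times n$ matrix with a one at position $(i,i+1)$ and zeros elsewhere. Denote its relaxation time by $T_{\rm rel}(n;[i_1,\dots,i_k])$. For $(i_1,\dots,i_k)=(1,2,\dots,n)$ it is the (full) matrix walk on the group $\mathcal M_n$ of upper triangular $n\times n$ matrices over $\mathbb F_2$ with ones on the diagonal. Let $T^{\rm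 East}_{\rm rel}(N)$, $N\ge 0$, be the relaxation time of the East process on $[N]=\{1,\dots,N\}$ at density $1/2$: the Markov chain on $\{0,1\}^{[N]}$ in which, for each $x\in[N]$ at rate one, the spin $\sigma(x)$ is replaced by a fresh Bernoulli$(1/2)$ variable if $x=1$ or $\sigma(x-1)=0$, and is left unchanged otherwise (a one-point chain if $N=0$). Theorem. For all $n\ge 1$, $k\ge 1$ and $1\le i_1<i_2<\dots<i_k\le n$, $$T_{\rm rel}(n;[i_1,i_2,\dots,i_k])=T^{\rm East}_{\rm rel}(i_k-1).$$ In particular, for every $n\ge 1$ the relaxation time and the spectral gap of the full matrix walk on $\mathcal M_n$ coincide with those of the East process on $[n-1]$ at density $1/2$. -/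

import Mathlib

open scoped ENNReal

/-! ### Spectral gap and relaxation time of a finite Markov chain -/

/-- The spectral gap of the generator `L` of a continuous time reversible Markov chain on a finite
state space `S`: the smallest eigenvalue of `-L` having a non-constant eigenfunction, i.e. the
second smallest eigenvalue of `-L` counted with multiplicity (`0` being the eigenvalue of the
constants). It is `∞` on a one-point space, where every function is constant. -/
noncomputable def spectralGap {S : Type*} (L : (S → ℝ) →ₗ[ℝ] (S → ℝ)) : ℝ≥0∞ :=
  ⨅ (lam : ℝ) (_ : ∃ f : S → ℝ, (∃ x y : S, f x ≠ f y) ∧ -(L f) = lam • f), ENNReal.ofReal lam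

/-- The relaxation time: the inverse of the spectral gap, with `1 / 0 = ∞` and `1 / ∞ = 0`. -/
noncomputable def relaxationTime {S : Type*} (L : (S → ℝ) →ₗ[ℝ] (S → ℝ)) : ℝ≥0∞ :=
  (spectralGap L)⁻¹

/-! ### The East process -/

/-- The constraint of the East process at the vertex `x`: either `x` is the first vertex, or the
spin of its left neighbour is `0`. Vertices are numbered from `0`. -/
def eastConstraint {N : ℕ} (σ : Fin N → Fin 2) (x : Fin N) : Prop :=
  x.val = 0 ∨ ∃ y : Fin N, y.val + 1 = x.val ∧ σ y = 0

open Classical in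
/-- The generator of the East process at density `p` on `N` vertices: each vertex at rate one, if
its constraint is satisfied, replaces its spin by a fresh Bernoulli(`p`) variable. -/
noncomputable def eastGenerator (p : ℝ) (N : ℕ) :
    ((Fin N → Fin 2) → ℝ) →ₗ[ℝ] ((Fin N → Fin 2) → ℝ) where
  toFun f σ := ∑ x : Fin N, if eastConstraint σ x then
    p * f (Function.update σ x 1) + (1 - p) * f (Function.update σ x 0) - f σ else 0
  map_add' f g := by
    funext σ
    simp only [Pi.add_apply, ← Finset.sum_add_distrib]
    refine Finset.sum_congr rfl fun x _ => ?_
    split_ifs <;> ring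
  map_smul' r f := by
    funext σ
    simp only [Pi.smul_apply, smul_eq_mul, RingHom.id_apply, Finset.mul_sum]
    refine Finset.sum_congr rfl fun x _ => ?_
    split_ifs <;> ring

/-! ### The upper triangular matrix walk -/

/-- For columns `c 0, …, c (k - 1)` of an `n × n` matrix, the set of `n × k` matrices over `𝔽₂`
whose `j`-th column vanishes below row `c j` and is equal to `1` at row `c j`. -/
def ColumnMatrix {n k : ℕ} (c : Fin k → Fin n) : Type :=
  {A : Matrix (Fin n) (Fin k) (ZMod 2) //
    (∀ i j, c j < i → A i j = 0) ∧ ∀ j, A (c j) j = 1}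

/-- The matrix `1 + a E^{i,i+1}` of size `m + 1`. -/
def rowOp {m : ℕ} (i : Fin m) (a : ZMod 2) : Matrix (Fin (m + 1)) (Fin (m + 1)) (ZMod 2) :=
  1 + a • Matrix.single i.castSucc i.succ (1 : ZMod 2)

theorem rowOp_mul_apply {m k : ℕ} (i : Fin m) (a : ZMod 2)
    (A : Matrix (Fin (m + 1)) (Fin k) (ZMod 2)) (r : Fin (m + 1)) (j : Fin k) :
    (rowOp i a * A) r j = A r j + if r = i.castSucc then a * A i.succ j else 0 := by
  unfold rowOp
  rw [Matrix.add_mul, Matrix.one_mul, Matrix.smul_mul, Matrix.add_apply, Matrix.smul_apply]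
  split_ifs with h
  · subst h
    simp
  · rw [Matrix.single_mul_apply_of_ne _ _ _ _ _ h, smul_zero]

/-- Left multiplication by `1 + a E^{i,i+1}`, i.e. addition of `a` times row `i + 1` to row `i`. -/
def addRow {m k : ℕ} {c : Fin k → Fin (m + 1)} (i : Fin m) (a : ZMod 2) (A : ColumnMatrix c) :
    ColumnMatrix c :=
  ⟨rowOp i a * A.1, by
    have key : ∀ r j, c j ≤ r → (rowOp i a * A.1) r j = A.1 r j := by
      intro r j hr
      rw [rowOp_mul_apply]
      split_ifs with h
      · have h' : c j < i.succ := lt_of_le_of_lt (h ▸ hr) (Fin.castSucc_lt_succ)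
        rw [A.2.1 _ _ h', mul_zero, add_zero]
      · rw [add_zero]
    exact ⟨fun r j hr => (key r j hr.le).trans (A.2.1 r j hr),
      fun j => (key _ j le_rfl).trans (A.2.2 j)⟩⟩

/-- The generator of the matrix walk on the columns `c` of matrices with `m + 1` rows:
`(L f)(A) = 1/2 ∑_{i} ∑_{a ∈ 𝔽₂} [f ((1 + a E^{i,i+1}) A) - f A]`, where `i` runs over all rows
but the last one. -/
noncomputable def matrixWalkGenerator {m k : ℕ} (c : Fin k → Fin (m + 1)) :
    (ColumnMatrix c → ℝ) →ₗ[ℝ] (ColumnMatrix c → ℝ) where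
  toFun f A := 1 / 2 * ∑ i : Fin m, ∑ a : ZMod 2, (f (addRow i a A) - f A)
  map_add' f g := by
    funext A
    simp only [Pi.add_apply, ← mul_add, ← Finset.sum_add_distrib]
    congr 1
    refine Finset.sum_congr rfl fun i _ => Finset.sum_congr rfl fun a _ => ?_
    ring
  map_smul' r f := by
    funext A
    simp only [Pi.smul_apply, smul_eq_mul, RingHom.id_apply, ← mul_sub, ← Finset.mul_sum]
    ring

/-- The generator of the full matrix walk on the upper triangular `(m + 1) × (m + 1)` matrices over
`𝔽₂` with ones on the diagonal: all the columns are retained. -/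
noncomputable def fullMatrixWalkGenerator (m : ℕ) :
    (ColumnMatrix (id : Fin (m + 1) → Fin (m + 1)) → ℝ) →ₗ[ℝ]
      (ColumnMatrix (id : Fin (m + 1) → Fin (m + 1)) → ℝ) :=
  matrixWalkGenerator id

/-! Upper bound for the gap: a column, read upwards from its leading one, evolves autonomously as an
East process whose facilitating value is 1 and whose frozen boundary spin is that leading one. East
eigenfunctions therefore lift to the matrix walk (`spectralGap_matrixWalk_le`).

Lower bound: given a non-constant eigenfunction, take the Fourier transform in the rightmost column
on which it depends. Row operations above the leading one move the frequency by the transposed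
operation `shear`; adding the row of the leading one multiplies by a sign (`colFourier_eigen`). The
zero frequency is an eigenfunction in fewer columns, with the same eigenvalue, which allows
induction if it is not constant. If it is constant, the other frequencies carry mass. By
Cauchy-Schwarz, their `ℓ²` norms over the matrices satisfy an energy bound for a killed shear
process on non-zero frequencies (`colFourierNorm_energy_le`).

The first 1 of a frequency never moves and acts as a frozen boundary, so this process splits into
shorter killed East processes. A killed East process is the odd sector of an East process with one
more vertex, so the East Poincaré constant bounds its energy (`EastPoincare.le_killed`,
`EastPoincare.le_shear`). -/

/-! ### The Rayleigh principle for symmetric generators -/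

/-- A symmetric operator annihilating the constants has a least eigenvalue on the functions of zero
sum, and this eigenvalue is a lower bound for the Rayleigh quotient of such functions. -/
theorem exists_eigenvalue_le_rayleigh {S : Type*} [Fintype S] [Nontrivial S]
    (T : (S → ℝ) →ₗ[ℝ] (S → ℝ))
    (hsymm : ∀ f g : S → ℝ, ∑ s, T f s * g s = ∑ s, f s * T g s) (hone : T (fun _ => 1) = 0) :
    ∃ γ : ℝ, (∃ h : S → ℝ, (∃ x y, h x ≠ h y) ∧ T h = γ • h) ∧
      ∀ G : S → ℝ, ∑ s, G s = 0 → γ * ∑ s, G s ^ 2 ≤ ∑ s, G s * T G s := by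
  classical
  let e := WithLp.linearEquiv 2 ℝ (S → ℝ)
  let T₁ : EuclideanSpace ℝ S →ₗ[ℝ] EuclideanSpace ℝ S := e.symm.toLinearMap ∘ₗ T ∘ₗ e.toLinearMap
  have hT₁ (x : EuclideanSpace ℝ S) (s : S) : T₁ x s = T x.ofLp s := rfl
  let φ : EuclideanSpace ℝ S →ₗ[ℝ] ℝ := ∑ s, LinearMap.proj s ∘ₗ e.toLinearMap
  have hφ (x : EuclideanSpace ℝ S) : φ x = ∑ s, x s := by
    simp only [φ, LinearMap.sum_apply]; rfl
  have hinner (x y : EuclideanSpace ℝ S) : inner ℝ x y = ∑ s, x s * y s := by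
    rw [PiLp.inner_apply]
    exact Finset.sum_congr rfl fun s _ => by simp [mul_comm]
  have hT₁symm : T₁.IsSymmetric := fun x y => by
    rw [hinner, hinner]; exact hsymm x.ofLp y.ofLp
  let V := LinearMap.ker φ
  have hV : ∀ v ∈ V, T₁ v ∈ V := fun v _ => by
    rw [LinearMap.mem_ker, hφ]
    simpa [hone, hT₁] using hsymm v.ofLp (fun _ => 1)
  obtain ⟨a, b, hab⟩ := exists_pair_ne S
  -- A difference of two point masses makes the zero-sum space non-trivial, so its least Rayleigh
  -- quotient is an eigenvalue.
  let w : EuclideanSpace ℝ S := WithLp.toLp 2 (Pi.single a 1 - Pi.single b 1)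
  have hw : w ∈ V := by rw [LinearMap.mem_ker, hφ]; simp [w]
  have hw0 : (⟨w, hw⟩ : V) ≠ 0 := fun h => by
    have := congrArg (fun v : V => (v : EuclideanSpace ℝ S) a) h
    simp [w, hab] at this
  have : Nontrivial V := ⟨⟨_, _, hw0⟩⟩
  let T₂ := T₁.restrict hV
  have hT₂ : T₂.IsSymmetric := hT₁symm.restrict_invariant hV
  have hev := hT₂.hasEigenvalue_iInf_of_finiteDimensional
  set γ := (⨅ x : { x : V // x ≠ 0 }, RCLike.re (inner ℝ (T₂ x) (x : V)) / ‖(x : V)‖ ^ 2 : ℝ)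
    with hγ
  obtain ⟨v, hv⟩ := hev.exists_hasEigenvector
  have hv1 : T₁ v = γ • (v : EuclideanSpace ℝ S) := congrArg Subtype.val hv.apply_eq_smul
  refine ⟨γ, ⟨(v : EuclideanSpace ℝ S).ofLp, ?_, ?_⟩, fun G hG => ?_⟩
  · by_contra! hc
    apply hv.2
    have hs := v.2
    rw [LinearMap.mem_ker, hφ] at hs
    ext s
    have : ∑ s', (v : EuclideanSpace ℝ S) s' = ∑ _s' : S, (v : EuclideanSpace ℝ S) s :=
      Finset.sum_congr rfl fun s' _ => hc _ _
    rw [hs, Finset.sum_const, Finset.card_univ, nsmul_eq_mul, eq_comm, mul_eq_zero] at this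
    simpa using this
  · funext s
    exact congrArg (fun x : EuclideanSpace ℝ S => x s) hv1
  · let x : EuclideanSpace ℝ S := WithLp.toLp 2 G
    have hx : x ∈ V := by rw [LinearMap.mem_ker, hφ]; exact hG
    have hnorm : ‖x‖ ^ 2 = ∑ s, G s ^ 2 := by simp [EuclideanSpace.norm_sq_eq, x]
    have hin : inner ℝ (T₁ x) x = ∑ s, G s * T G s := by
      rw [hinner]; exact Finset.sum_congr rfl fun s _ => mul_comm _ _
    by_cases hx0 : x = 0
    · have hG0 : G = 0 := congrArg WithLp.ofLp hx0
      simp [hG0]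
    · have hx0' : (⟨x, hx⟩ : V) ≠ 0 := fun h => hx0 (congrArg Subtype.val h)
      -- A real infimum is a lower bound only for a set bounded below; the operator norm supplies
      -- the bound.
      have hbdd : BddBelow (Set.range fun x : { x : V // x ≠ 0 } =>
          (RCLike.re (inner ℝ (T₂ x) (x : V)) / ‖(x : V)‖ ^ 2 : ℝ)) := by
        refine ⟨-‖LinearMap.toContinuousLinearMap T₂‖, ?_⟩
        rintro _ ⟨y, rfl⟩
        have hy : 0 < ‖(y : V)‖ := norm_pos_iff.2 y.2
        have h1 := abs_real_inner_le_norm (T₂ y) (y : V)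
        have h2 := (LinearMap.toContinuousLinearMap T₂).le_opNorm (y : V)
        rw [LinearMap.coe_toContinuousLinearMap'] at h2
        have h3 := mul_le_mul_of_nonneg_right h2 hy.le
        change -_ ≤ inner ℝ (T₂ y) (y : V) / ‖(y : V)‖ ^ 2
        rw [le_div_iff₀ (by positivity)]
        have h4 := neg_abs_le (inner ℝ (T₂ y) (y : V))
        nlinarith
      have hle := ciInf_le hbdd ⟨⟨x, hx⟩, hx0'⟩
      rw [← hγ] at hle
      have hpos : 0 < ‖x‖ ^ 2 := by have := norm_pos_iff.2 hx0; positivity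
      change γ ≤ inner ℝ (T₁ x) x / ‖x‖ ^ 2 at hle
      rwa [le_div_iff₀ hpos, hnorm, hin] at hle

/-! ### The East process in linear coordinates -/

/-- Add to each entry but the first one the entry to its left, at the single place `i + 1`. -/
def shear {N : ℕ} (i : Fin N) (S : Fin (N + 1) → ZMod 2) : Fin (N + 1) → ZMod 2 :=
  S + Pi.single i.succ (S i.castSucc)

/-- A legal flip of the East process at `x`, where the spin `1` is the facilitating one and the
frozen spin to the left of the first vertex is `1`. -/
def eastStep {N : ℕ} (x : Fin N) (S : Fin N → ZMod 2) : Fin N → ZMod 2 :=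
  S + Pi.single x ((Fin.cons 1 S : Fin (N + 1) → ZMod 2) x.castSucc)

theorem cons_add_single {N : ℕ} (b : ZMod 2) (S : Fin N → ZMod 2) (x : Fin N) (a : ZMod 2) :
    (Fin.cons b (S + Pi.single x a) : Fin (N + 1) → ZMod 2) =
      Fin.cons b S + Pi.single x.succ a := by
  funext i
  refine Fin.cases ?_ (fun i => ?_) i
  · simp
  · by_cases h : i = x
    · subst h; simp
    · simp [h]

theorem snoc_add_single {N : ℕ} (b : ZMod 2) (S : Fin N → ZMod 2) (x : Fin N) (a : ZMod 2) :
    (Fin.snoc (S + Pi.single x a) b : Fin (N + 1) → ZMod 2) =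
      (Fin.snoc S b : Fin (N + 1) → ZMod 2) + Pi.single x.castSucc a := by
  funext i
  refine Fin.lastCases ?_ (fun i => ?_) i
  · simp
  · by_cases h : i = x
    · subst h; simp
    · simp [h]

/-- The first entry is never altered by a shear, so a leading 1 plays the role of the frozen
boundary spin. -/
theorem shear_cons_one {N : ℕ} (x : Fin N) (S : Fin N → ZMod 2) :
    shear x (Fin.cons 1 S) = Fin.cons 1 (eastStep x S) := by
  rw [shear, eastStep, cons_add_single]

theorem shear_zero_cons_zero {N : ℕ} (S : Fin (N + 1) → ZMod 2) :
    shear 0 (Fin.cons 0 S) = Fin.cons 0 S := by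
  simp [shear]

theorem shear_succ_cons {N : ℕ} (b : ZMod 2) (x : Fin N) (S : Fin (N + 1) → ZMod 2) :
    shear x.succ (Fin.cons b S) = Fin.cons b (shear x S) := by
  rw [shear, shear, cons_add_single, ← Fin.succ_castSucc, Fin.cons_succ]

theorem shear_involutive {N : ℕ} (i : Fin N) : Function.Involutive (shear i) := fun S => by
  have h : shear i S i.castSucc = S i.castSucc := by
    simp [shear, Fin.castSucc_lt_succ.ne]
  rw [shear, h, shear, add_assoc, CharTwo.add_self_eq_zero, add_zero]

theorem eastStep_involutive {N : ℕ} (x : Fin N) : Function.Involutive (eastStep x) := fun S => by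
  have h := shear_involutive x (Fin.cons 1 S)
  rw [shear_cons_one, shear_cons_one] at h
  exact Fin.cons_right_injective _ h

theorem eastStep_castSucc_snoc {N : ℕ} (x : Fin N) (S : Fin N → ZMod 2) (b : ZMod 2) :
    eastStep x.castSucc (Fin.snoc S b) = Fin.snoc (eastStep x S) b := by
  rw [eastStep, eastStep, snoc_add_single, Fin.cons_snoc_eq_snoc_cons, Fin.snoc_castSucc]

theorem eastStep_last_snoc {N : ℕ} (S : Fin N → ZMod 2) (b : ZMod 2) :
    eastStep (Fin.last N) (Fin.snoc S b) =
      Fin.snoc S (b + (Fin.cons 1 S : Fin (N + 1) → ZMod 2) (Fin.last N)) := by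
  rw [eastStep, Fin.cons_snoc_eq_snoc_cons, Fin.snoc_castSucc]
  funext i
  refine Fin.lastCases ?_ (fun i => ?_) i
  · simp
  · simp

theorem sum_cons {N : ℕ} (φ : (Fin (N + 1) → ZMod 2) → ℝ) :
    ∑ S, φ S = ∑ S, φ (Fin.cons 0 S) + ∑ S, φ (Fin.cons 1 S) := by
  rw [← (Fin.consEquiv fun _ : Fin (N + 1) => ZMod 2).sum_comp, Fintype.sum_prod_type]
  exact Fin.sum_univ_two _

theorem sum_snoc {N : ℕ} (φ : (Fin (N + 1) → ZMod 2) → ℝ) :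
    ∑ S, φ S = ∑ S, (φ (Fin.snoc S 0) + φ (Fin.snoc S 1)) := by
  rw [← (Fin.snocEquiv fun _ : Fin (N + 1) => ZMod 2).sum_comp, Fintype.sum_prod_type,
    Finset.sum_add_distrib]
  exact Fin.sum_univ_two _

/-! ### Poincaré inequalities for the East process and its killed versions -/

/-- The Poincaré inequality with constant `γ` for the East process on `N` vertices. -/
def EastPoincare (N : ℕ) (γ : ℝ) : Prop :=
  ∀ G : (Fin N → ZMod 2) → ℝ, ∑ S, G S = 0 →
    γ * ∑ S, G S ^ 2 ≤ ∑ S, ∑ x, 1 / 2 * (G S ^ 2 - G S * G (eastStep x S))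

/-- Test functions that ignore the last spin do not feel its flips, and both sides merely double. -/
theorem EastPoincare.of_succ {N : ℕ} {γ : ℝ} (h : EastPoincare (N + 1) γ) : EastPoincare N γ := by
  intro G hG
  have := h (fun S => G (Fin.init S)) (by
    rw [sum_snoc]
    simp only [Fin.init_snoc, Finset.sum_add_distrib, hG, add_zero])
  simp only [sum_snoc, Fin.sum_univ_castSucc, Fin.init_snoc, eastStep_castSucc_snoc,
    eastStep_last_snoc, ← sq, sub_self, add_zero, ← two_mul, ← Finset.mul_sum] at this
  simp only [← Finset.mul_sum]
  linarith

theorem EastPoincare.mono {M N : ℕ} (hMN : M ≤ N) {γ : ℝ} (h : EastPoincare N γ) :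
    EastPoincare M γ := by
  induction N, hMN using Nat.le_induction with
  | base => exact h
  | succ N _ ih => exact ih h.of_succ

/-- The non-trivial character of `𝔽₂`. -/
def sgn (a : ZMod 2) : ℝ := if a = 0 then 1 else -1

@[simp] theorem sgn_zero : sgn 0 = 1 := if_pos rfl

@[simp] theorem sgn_one : sgn 1 = -1 := if_neg one_ne_zero

theorem zmod_two_cases (a : ZMod 2) : a = 0 ∨ a = 1 := by
  revert a; decide

theorem sgn_add (a b : ZMod 2) : sgn (a + b) = sgn a * sgn b := by
  rcases zmod_two_cases a with rfl | rfl <;> rcases zmod_two_cases b with rfl | rfl <;>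
    simp [CharTwo.add_self_eq_zero]

/-- The East process killed at rate one whenever the last vertex facilitates: its bottom eigenvalue
is that of the functions on one more vertex which are odd in the last spin. -/
theorem EastPoincare.le_killed {N : ℕ} {γ : ℝ} (h : EastPoincare (N + 1) γ)
    (F : (Fin N → ZMod 2) → ℝ) :
    γ * ∑ S, F S ^ 2 ≤ ∑ S, (∑ x, 1 / 2 * (F S ^ 2 - F S * F (eastStep x S)) +
      1 / 2 * (1 - sgn ((Fin.cons 1 S : Fin (N + 1) → ZMod 2) (Fin.last N))) * F S ^ 2) := by
  -- Oddness in the last spin makes the sum vanish whatever `F` is; each legal flip of that spin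
  -- changes the sign and so produces the killing term.
  have := h (fun S => F (Fin.init S) * sgn (S (Fin.last N))) (by
    rw [sum_snoc]
    refine Finset.sum_eq_zero fun S _ => ?_
    simp)
  simp only [sum_snoc, Fin.sum_univ_castSucc, Fin.init_snoc, eastStep_castSucc_snoc,
    eastStep_last_snoc, Fin.snoc_last, sgn_add, sgn_zero, sgn_one] at this
  have e1 : ∑ S, ((F S * 1) ^ 2 + (F S * -1) ^ 2) = 2 * ∑ S, F S ^ 2 := by
    rw [Finset.mul_sum]; exact Finset.sum_congr rfl fun S _ => by ring
  rw [e1] at this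
  refine le_of_mul_le_mul_left ?_ (zero_lt_two' ℝ)
  refine (le_of_eq (by ring)).trans (this.trans_eq ?_)
  rw [Finset.mul_sum]
  refine Finset.sum_congr rfl fun S _ => ?_
  have e2 : ∀ c : ℝ, c ^ 2 = 1 → ∑ x, 1 / 2 * ((F S * c) ^ 2 - F S * c * (F (eastStep x S) * c)) =
      ∑ x, 1 / 2 * (F S ^ 2 - F S * F (eastStep x S)) := fun c hc =>
    Finset.sum_congr rfl fun x _ => by
      linear_combination (1 / 2 * (F S ^ 2 - F S * F (eastStep x S))) * hc
  rw [e2 1 (by norm_num), e2 (-1) (by norm_num)]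
  ring

/-- The East process without frozen left neighbour, killed when the last vertex facilitates and
started away from the empty configuration. -/
theorem EastPoincare.le_shear : ∀ {M : ℕ} {γ : ℝ}, EastPoincare (M + 1) γ →
    ∀ F : (Fin (M + 1) → ZMod 2) → ℝ, F 0 = 0 →
    γ * ∑ S, F S ^ 2 ≤ ∑ S, (∑ i : Fin M, 1 / 2 * (F S ^ 2 - F S * F (shear i S)) +
      1 / 2 * (1 - sgn (S (Fin.last M))) * F S ^ 2) := by
  intro M
  induction M with
  | zero =>
    intro γ h F hF
    have h1 := h.le_killed fun S => F (Fin.cons 1 S)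
    rw [sum_cons, sum_cons]
    have hz : ∀ S : Fin 0 → ZMod 2, F (Fin.cons 0 S) = 0 := fun S => by
      rw [← hF]; congr 1; funext i; fin_cases i; rfl
    simpa [hz] using h1
  | succ M ih =>
    intro γ h F hF
    -- Split according to the first entry: after a 1 the rest is a killed East process, after a 0
    -- the rest is the same problem with one vertex fewer.
    have h1 := h.le_killed fun S => F (Fin.cons 1 S)
    have h0 := ih h.of_succ (fun S => F (Fin.cons 0 S)) (by
      rw [← hF]; congr 1; funext i; refine Fin.cases ?_ (fun i => ?_) i <;> simp)
    rw [sum_cons (N := M + 1), sum_cons (N := M + 1), mul_add]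
    refine add_le_add (h0.trans_eq ?_) (h1.trans_eq ?_)
    · refine Finset.sum_congr rfl fun S _ => ?_
      rw [Fin.sum_univ_succ, shear_zero_cons_zero, ← Fin.succ_last, Fin.cons_succ]
      simp only [shear_succ_cons]
      ring
    · simp only [shear_cons_one]

/-! ### The East generator in linear coordinates and its gap -/

/-- The operator `-L` of the East process in linear coordinates. -/
noncomputable def eastOp (N : ℕ) : ((Fin N → ZMod 2) → ℝ) →ₗ[ℝ] ((Fin N → ZMod 2) → ℝ) where
  toFun f S := ∑ x, 1 / 2 * (f S - f (eastStep x S))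
  map_add' f g := by
    funext S
    simp only [Pi.add_apply, ← Finset.sum_add_distrib]
    exact Finset.sum_congr rfl fun x _ => by ring
  map_smul' r f := by
    funext S
    simp only [Pi.smul_apply, smul_eq_mul, RingHom.id_apply, Finset.mul_sum]
    exact Finset.sum_congr rfl fun x _ => by ring

theorem eastOp_apply {N : ℕ} (f : (Fin N → ZMod 2) → ℝ) (S : Fin N → ZMod 2) :
    eastOp N f S = ∑ x, 1 / 2 * (f S - f (eastStep x S)) := rfl

theorem eastOp_symm {N : ℕ} (f g : (Fin N → ZMod 2) → ℝ) :
    ∑ S, eastOp N f S * g S = ∑ S, f S * eastOp N g S := by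
  simp only [eastOp_apply, Finset.mul_sum, Finset.sum_mul]
  rw [Finset.sum_comm]
  conv_rhs => rw [Finset.sum_comm]
  refine Finset.sum_congr rfl fun x _ => ?_
  have h : ∑ S, f (eastStep x S) * g S = ∑ S, f S * g (eastStep x S) := by
    rw [← Equiv.sum_comp (eastStep_involutive x).toPerm]
    exact Finset.sum_congr rfl fun S _ => by
      simp [(eastStep_involutive x) S]
  rw [← sub_eq_zero, ← Finset.sum_sub_distrib] at h ⊢
  rw [← mul_zero (-1 / 2 : ℝ), ← h, Finset.mul_sum]
  exact Finset.sum_congr rfl fun S _ => by ring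

/-- The exchange of the facilitating values `1 : ZMod 2` and `0 : Fin 2`. -/
def spinFlip : ZMod 2 ≃ Fin 2 where
  toFun a := if a = 0 then 1 else 0
  invFun b := if b = 0 then 1 else 0
  left_inv := by decide
  right_inv := by decide

/-- Linear coordinates for the configurations of the East process. -/
def spin {N : ℕ} : (Fin N → ZMod 2) ≃ (Fin N → Fin 2) :=
  Equiv.arrowCongr (Equiv.refl _) spinFlip

theorem spin_apply {N : ℕ} (S : Fin N → ZMod 2) (x : Fin N) : spin S x = spinFlip (S x) := rfl

theorem eastConstraint_spin_iff {N : ℕ} (S : Fin N → ZMod 2) (x : Fin N) :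
    eastConstraint (spin S) x ↔ (Fin.cons 1 S : Fin (N + 1) → ZMod 2) x.castSucc = 1 := by
  cases N with
  | zero => exact x.elim0
  | succ N =>
    have h01 : ∀ a : ZMod 2, spinFlip a = 0 ↔ a = 1 := by decide
    refine Fin.cases ?_ (fun y => ?_) x
    · simp [eastConstraint]
    · rw [← Fin.succ_castSucc, Fin.cons_succ, ← h01, eastConstraint]
      constructor
      · rintro (h | ⟨z, hz, h⟩)
        · simp at h
        · have : z = y.castSucc := Fin.ext (by simpa using hz)
          rwa [this] at h
      · exact fun h => Or.inr ⟨y.castSucc, by simp, h⟩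

/-- A fresh fair spin averages the current configuration and the flipped one, which leaves half the
difference across the flip. -/
theorem eastGenerator_spin {N : ℕ} (f : (Fin N → Fin 2) → ℝ) (S : Fin N → ZMod 2) :
    -(eastGenerator (1 / 2) N f (spin S)) = eastOp N (fun S => f (spin S)) S := by
  rw [eastOp_apply]
  simp only [eastGenerator, LinearMap.coe_mk, AddHom.coe_mk, ← Finset.sum_neg_distrib]
  refine Finset.sum_congr rfl fun x _ => ?_
  rw [eastConstraint_spin_iff]
  have hupd : ∀ a : ZMod 2, spin (S + Pi.single x a) =
      Function.update (spin S) x (spinFlip (S x + a)) := fun a => by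
    funext y
    by_cases h : y = x
    · subst h; simp [spin_apply]
    · simp [spin_apply, h]
  split_ifs with h
  · rw [eastStep, h, hupd]
    have hself := hupd 0
    rw [Pi.single_zero, add_zero, add_zero] at hself
    have f0 : spinFlip 0 = 1 := rfl
    have f1 : spinFlip 1 = 0 := rfl
    rcases zmod_two_cases (S x) with hS | hS
    · rw [hS, f0] at hself
      rw [hS, zero_add, f1, ← hself]
      ring
    · rw [hS, f1] at hself
      rw [hS, CharTwo.add_self_eq_zero, f0, ← hself]
      ring
  · rw [eastStep, (zmod_two_cases _).resolve_right h, Pi.single_zero, add_zero]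
    ring

/-- The bottom of the spectrum of the East process on the functions of zero mean. -/
theorem exists_east_gap {N : ℕ} (hN : N ≠ 0) :
    ∃ γ : ℝ, (∃ h : (Fin N → Fin 2) → ℝ, (∃ σ τ, h σ ≠ h τ) ∧
      -(eastGenerator (1 / 2) N h) = γ • h) ∧ EastPoincare N γ := by
  have : NeZero N := ⟨hN⟩
  obtain ⟨γ, ⟨h, ⟨x, y, hxy⟩, heig⟩, hP⟩ := exists_eigenvalue_le_rayleigh (eastOp N)
    eastOp_symm (by funext S; simp [eastOp_apply])
  refine ⟨γ, ⟨fun σ => h (spin.symm σ), ⟨spin x, spin y, by simpa using hxy⟩, ?_⟩, ?_⟩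
  · funext σ
    obtain ⟨S, rfl⟩ := spin.surjective σ
    rw [Pi.neg_apply, eastGenerator_spin]
    simp only [Equiv.symm_apply_apply, Pi.smul_apply]
    exact congrFun heig S
  · intro G hG
    refine (hP G hG).trans_eq (Finset.sum_congr rfl fun S _ => ?_)
    rw [eastOp_apply, Finset.mul_sum]
    exact Finset.sum_congr rfl fun x _ => by ring

/-! ### The matrix walk -/

instance {n k : ℕ} (c : Fin k → Fin n) : Finite (ColumnMatrix c) :=
  inferInstanceAs (Finite {A : Matrix (Fin n) (Fin k) (ZMod 2) //
    (∀ i j, c j < i → A i j = 0) ∧ ∀ j, A (c j) j = 1})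

noncomputable instance {n k : ℕ} (c : Fin k → Fin n) : Fintype (ColumnMatrix c) :=
  Fintype.ofFinite _

section
variable {m k : ℕ} {c : Fin k → Fin (m + 1)}

theorem ColumnMatrix.ext' {A B : ColumnMatrix c} (h : ∀ r j, A.1 r j = B.1 r j) : A = B :=
  Subtype.ext (Matrix.ext h)

theorem addRow_apply (i : Fin m) (a : ZMod 2) (A : ColumnMatrix c) (r : Fin (m + 1)) (j : Fin k) :
    (addRow i a A).1 r j = A.1 r j + if r = i.castSucc then a * A.1 i.succ j else 0 :=
  rowOp_mul_apply i a A.1 r j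

theorem addRow_zero (i : Fin m) (A : ColumnMatrix c) : addRow i 0 A = A :=
  ColumnMatrix.ext' fun r j => by simp [addRow_apply]

theorem addRow_one_involutive (i : Fin m) :
    Function.Involutive (addRow i 1 : ColumnMatrix c → ColumnMatrix c) := fun A =>
  ColumnMatrix.ext' fun r j => by
    have h : i.succ ≠ i.castSucc := Fin.castSucc_lt_succ.ne'
    simp only [addRow_apply, if_neg h, add_zero, add_assoc, CharTwo.add_self_eq_zero]

theorem neg_matrixWalkGenerator_apply (f : ColumnMatrix c → ℝ) (A : ColumnMatrix c) :
    -(matrixWalkGenerator c f A) = ∑ i, 1 / 2 * (f A - f (addRow i 1 A)) := by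
  simp only [matrixWalkGenerator, LinearMap.coe_mk, AddHom.coe_mk, Finset.mul_sum,
    ← Finset.sum_neg_distrib]
  refine Finset.sum_congr rfl fun i _ => ?_
  have h : ∀ φ : ZMod 2 → ℝ, ∑ a, φ a = φ 0 + φ 1 := fun φ => Fin.sum_univ_two φ
  rw [h, addRow_zero]
  ring

theorem sum_castLE {M : ℕ} (h : M ≤ m) (φ : Fin m → ℝ) (hφ : ∀ i : Fin m, M ≤ i.val → φ i = 0) :
    ∑ i, φ i = ∑ i : Fin M, φ (Fin.castLE h i) := by
  symm
  refine Finset.sum_of_injOn (Fin.castLE h) (Fin.castLE_injective h).injOn (by simp) ?_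
    fun _ _ => rfl
  intro i _ hi
  refine hφ i (not_lt.1 fun hlt => hi ?_)
  exact ⟨⟨i, hlt⟩, by simp, rfl⟩

/-- Add the vector `v` to the first `N` entries of the column `j`, above its leading one. -/
def addCol {N : ℕ} (j : Fin k) (hN : N ≤ (c j).val) (v : Fin N → ZMod 2) (A : ColumnMatrix c) :
    ColumnMatrix c :=
  ⟨Matrix.of fun r j' => A.1 r j' + if h : j' = j ∧ r.val < N then v ⟨r, h.2⟩ else 0, by
    constructor
    · intro r j' hr
      rw [Matrix.of_apply, dif_neg, add_zero, A.2.1 r j' hr]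
      rintro ⟨rfl, h⟩
      have : (c j').val < r.val := hr
      omega
    · intro j'
      rw [Matrix.of_apply, dif_neg, add_zero, A.2.2 j']
      rintro ⟨rfl, h⟩
      omega⟩

section
variable {N : ℕ} {j : Fin k} (hN : N ≤ (c j).val)

theorem addCol_apply (v : Fin N → ZMod 2) (A : ColumnMatrix c) (r : Fin (m + 1)) (j' : Fin k) :
    (addCol j hN v A).1 r j' =
      A.1 r j' + if h : j' = j ∧ r.val < N then v ⟨r, h.2⟩ else 0 := rfl

theorem addCol_add (v w : Fin N → ZMod 2) (A : ColumnMatrix c) :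
    addCol j hN v (addCol j hN w A) = addCol j hN (v + w) A :=
  ColumnMatrix.ext' fun r j' => by
    simp only [addCol_apply]
    split_ifs
    · rw [Pi.add_apply]; ring
    · simp

theorem addCol_zero (A : ColumnMatrix c) : addCol j hN 0 A = A :=
  ColumnMatrix.ext' fun r j' => by simp [addCol_apply]

theorem addCol_apply_of_ne (v : Fin N → ZMod 2) (A : ColumnMatrix c) (r : Fin (m + 1))
    {j' : Fin k} (h : j' ≠ j) : (addCol j hN v A).1 r j' = A.1 r j' := by
  rw [addCol_apply, dif_neg (fun h' => h h'.1), add_zero]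

theorem addCol_apply_of_lt (v : Fin N → ZMod 2) (A : ColumnMatrix c) {r : Fin (m + 1)}
    (h : r.val < N) : (addCol j hN v A).1 r j = A.1 r j + v ⟨r, h⟩ := by
  rw [addCol_apply, dif_pos ⟨rfl, h⟩]

theorem addCol_apply_of_le (v : Fin N → ZMod 2) (A : ColumnMatrix c) {r : Fin (m + 1)}
    (h : N ≤ r.val) (j' : Fin k) : (addCol j hN v A).1 r j' = A.1 r j' := by
  rw [addCol_apply, dif_neg (fun h' => absurd h'.2 (not_lt.2 h)), add_zero]

end

/-! ### The projection onto one column -/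

/-- The entries of the column `j` above its leading one, listed upwards. -/
def readCol (j : Fin k) (A : ColumnMatrix c) : Fin (c j).val → ZMod 2 :=
  fun x => A.1 (Fin.castLE (c j).is_le x.rev).castSucc j

theorem readCol_surjective (j : Fin k) :
    Function.Surjective (readCol j : ColumnMatrix c → Fin (c j).val → ZMod 2) := by
  intro S
  let B : ColumnMatrix c := ⟨fun r j' => if r = c j' then 1 else 0,
    fun r j' hr => if_neg hr.ne', fun j' => if_pos rfl⟩
  refine ⟨addCol j le_rfl (fun x => S x.rev) B, funext fun x => ?_⟩
  have hx : (Fin.castLE (c j).is_le x.rev).castSucc.val < (c j).val := x.rev.isLt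
  have hB : B.1 (Fin.castLE (c j).is_le x.rev).castSucc j = 0 :=
    if_neg fun h => hx.ne (congrArg Fin.val h)
  rw [readCol, addCol_apply_of_lt _ _ _ hx, hB, zero_add]
  exact congrArg S (Fin.rev_rev x)

theorem readCol_addRow_of_le (j : Fin k) (i : Fin m) (hi : (c j).val ≤ i.val)
    (A : ColumnMatrix c) : readCol j (addRow i 1 A) = readCol j A := by
  funext x
  have hx : (Fin.castLE (c j).is_le x.rev).castSucc.val < (c j).val := x.rev.isLt
  rw [readCol, addRow_apply, if_neg, add_zero, readCol]
  intro h
  rw [h] at hx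
  exact absurd hx (not_lt.2 hi)

/-- Upward reading turns the entry one row below into the left neighbour; below the first entry read
lies the leading one of the column. -/
theorem readCol_addRow_castLE (j : Fin k) (x : Fin (c j).val) (A : ColumnMatrix c) :
    readCol j (addRow (Fin.castLE (c j).is_le x.rev) 1 A) = eastStep x (readCol j A) := by
  have hval : A.1 (Fin.castLE (c j).is_le x.rev).succ j =
      (Fin.cons 1 (readCol j A) : Fin ((c j).val + 1) → ZMod 2) x.castSucc := by
    rcases Nat.eq_zero_or_pos x.val with hx | hx
    · have h1 : x.castSucc = 0 := Fin.ext hx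
      have h2 : (Fin.castLE (c j).is_le x.rev).succ = c j := Fin.ext (by
        simp only [Fin.val_succ, Fin.val_castLE, Fin.val_rev]; omega)
      rw [h1, h2, Fin.cons_zero, A.2.2]
    · let y : Fin (c j).val := ⟨x.val - 1, by omega⟩
      have h1 : x.castSucc = y.succ := Fin.ext (by
        simp only [Fin.val_succ, Fin.val_castSucc, y]; omega)
      have h2 : (Fin.castLE (c j).is_le x.rev).succ = (Fin.castLE (c j).is_le y.rev).castSucc :=
        Fin.ext (by
          simp only [Fin.val_succ, Fin.val_castSucc, Fin.val_castLE, Fin.val_rev, y]; omega)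
      rw [h1, h2, Fin.cons_succ, readCol]
  funext y
  rw [eastStep, ← hval, Pi.add_apply, readCol, addRow_apply, one_mul, readCol]
  congr 1
  by_cases h : y = x
  · subst h; simp
  · rw [Pi.single_eq_of_ne h, if_neg]
    intro h'
    apply h
    have h1 := Fin.castLE_injective _ (Fin.castSucc_injective _ h')
    exact Fin.rev_injective h1

theorem spectralGap_matrixWalk_le (j : Fin k) :
    spectralGap (matrixWalkGenerator c) ≤ spectralGap (eastGenerator (1 / 2) (c j).val) := by
  refine le_iInf₂ fun lam h => ?_
  obtain ⟨f, ⟨σ, τ, hne⟩, heig⟩ := h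
  refine iInf₂_le lam ⟨fun A => f (spin (readCol j A)), ?_, ?_⟩
  · obtain ⟨A, hA⟩ := readCol_surjective (c := c) j (spin.symm σ)
    obtain ⟨B, hB⟩ := readCol_surjective (c := c) j (spin.symm τ)
    exact ⟨A, B, by simpa [hA, hB] using hne⟩
  · funext A
    have h := congrFun heig (spin (readCol j A))
    rw [Pi.neg_apply, eastGenerator_spin, eastOp_apply] at h
    rw [Pi.neg_apply, neg_matrixWalkGenerator_apply, Pi.smul_apply]
    refine Eq.trans ?_ h
    rw [sum_castLE (c j).is_le]
    · rw [← Equiv.sum_comp Fin.revPerm]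
      exact Finset.sum_congr rfl fun x _ => by rw [Fin.revPerm_apply, readCol_addRow_castLE]
    · intro i hi
      rw [readCol_addRow_of_le j i hi, sub_self, mul_zero]

/-! ### Fourier transform in one column -/

/-- The Fourier transform of `f` in the first `N` entries of the column `j`. -/
noncomputable def colFourier {N : ℕ} {j : Fin k} (hN : N ≤ (c j).val) (f : ColumnMatrix c → ℝ)
    (S : Fin N → ZMod 2) (A : ColumnMatrix c) : ℝ :=
  ∑ v, sgn (S ⬝ᵥ v) * f (addCol j hN v A)

theorem sum_sgn_dotProduct {N : ℕ} (v : Fin N → ZMod 2) :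
    ∑ S, sgn (S ⬝ᵥ v) = if v = 0 then 2 ^ N else 0 := by
  split_ifs with h
  · subst h; simp [ZMod.card]
  · obtain ⟨x, hx⟩ := Function.ne_iff.1 h
    have hx1 : v x = 1 := (zmod_two_cases _).resolve_left hx
    -- Shifting `S` at a coordinate where `v` is 1 reverses every sign.
    have key : ∑ S, sgn (S ⬝ᵥ v) = ∑ S, -sgn (S ⬝ᵥ v) := by
      rw [← Equiv.sum_comp (Equiv.addRight (Pi.single x 1))]
      refine Finset.sum_congr rfl fun S _ => ?_
      rw [Equiv.coe_addRight, add_dotProduct, single_one_dotProduct, hx1, sgn_add, sgn_one]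
      ring
    rw [Finset.sum_neg_distrib] at key
    linarith

theorem sum_colFourier {N : ℕ} {j : Fin k} (hN : N ≤ (c j).val) (f : ColumnMatrix c → ℝ)
    (A : ColumnMatrix c) : ∑ S, colFourier hN f S A = 2 ^ N * f A := by
  simp only [colFourier]
  rw [Finset.sum_comm]
  simp only [← Finset.sum_mul, sum_sgn_dotProduct]
  simp [addCol_zero]

/-- `f` depends on the columns `< d` only. -/
def DependsOnColumns (d : ℕ) (f : ColumnMatrix c → ℝ) : Prop :=
  ∀ A B : ColumnMatrix c, (∀ r (j : Fin k), j.val < d → A.1 r j = B.1 r j) → f A = f B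

/-- Frequency zero sums over all fillings of the column; translation by the difference `w` of the
two columns matches the sums. -/
theorem DependsOnColumns.colFourier_zero {N : ℕ} {j : Fin k} (hN : (c j).val = N)
    {f : ColumnMatrix c → ℝ} (hf : DependsOnColumns (j.val + 1) f) :
    DependsOnColumns j.val (colFourier hN.ge f 0) := by
  subst hN
  intro A B hAB
  let w : Fin (c j).val → ZMod 2 := fun x =>
    B.1 ⟨x, x.isLt.trans (c j).isLt⟩ j - A.1 ⟨x, x.isLt.trans (c j).isLt⟩ j
  simp only [colFourier, zero_dotProduct, sgn_zero, one_mul]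
  rw [← Equiv.sum_comp (Equiv.addRight w)]
  refine Finset.sum_congr rfl fun v _ => ?_
  rw [Equiv.coe_addRight, ← addCol_add]
  apply hf
  intro r j' hj'
  rw [addCol_apply _ v, addCol_apply _ v]
  congr 1
  rcases Nat.lt_succ_iff_lt_or_eq.1 hj' with h | h
  · rw [addCol_apply_of_ne _ _ _ _ (fun e => h.ne (congrArg Fin.val e)), hAB r j' h]
  · obtain rfl : j' = j := Fin.ext h
    rcases lt_trichotomy r (c j') with h' | h' | h'
    · rw [addCol_apply_of_lt _ _ _ h']
      simp [w]
    · rw [addCol_apply_of_le _ _ _ (le_of_eq (congrArg Fin.val h'.symm)), h', A.2.2, B.2.2]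
    · rw [addCol_apply_of_le _ _ _ (le_of_lt h'), A.2.1 _ _ h', B.2.1 _ _ h']

/-- The action of a row operation on a vector of entries of one column. -/
def rowShear {M : ℕ} (i : Fin M) (v : Fin (M + 1) → ZMod 2) : Fin (M + 1) → ZMod 2 :=
  v + Pi.single i.castSucc (v i.succ)

theorem rowShear_involutive {M : ℕ} (i : Fin M) : Function.Involutive (rowShear i) := fun v => by
  have h : rowShear i v i.succ = v i.succ := by
    simp [rowShear, Fin.castSucc_lt_succ.ne']
  rw [rowShear, h, rowShear, add_assoc, CharTwo.add_self_eq_zero, add_zero]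

/-- The two shears are transposes of each other, which is why row operations act on frequencies by
`shear`. -/
theorem dotProduct_rowShear {M : ℕ} (i : Fin M) (S v : Fin (M + 1) → ZMod 2) :
    S ⬝ᵥ rowShear i v = shear i S ⬝ᵥ v := by
  rw [rowShear, shear, dotProduct_add, add_dotProduct, dotProduct_single, single_dotProduct]

section
variable {M : ℕ} {j : Fin k} (hM : (c j).val = M + 1)

theorem le_of_val_eq_succ {j : Fin k} (hM : (c j).val = M + 1) : M + 1 ≤ m := hM ▸ (c j).is_le

theorem addRow_addCol (i : Fin M) (v : Fin (M + 1) → ZMod 2) (A : ColumnMatrix c) :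
    addRow (Fin.castLE (le_of_val_eq_succ hM) i.castSucc) 1 (addCol j hM.ge v A) =
      addCol j hM.ge (rowShear i v) (addRow (Fin.castLE (le_of_val_eq_succ hM) i.castSucc) 1 A) :=
  ColumnMatrix.ext' fun r j' => by
    set i' := Fin.castLE (le_of_val_eq_succ hM) i.castSucc with hi'
    have hs : i'.succ.val = i.succ.val := rfl
    have hc : i'.castSucc.val = i.val := rfl
    by_cases hj : j' = j
    · subst hj
      have hlt : i'.succ.val < M + 1 := i.succ.isLt
      rw [addRow_apply, addCol_apply_of_lt _ _ _ hlt]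
      by_cases hr : r.val < M + 1
      · rw [addCol_apply_of_lt _ _ _ hr, addCol_apply_of_lt _ _ _ hr, addRow_apply, rowShear,
          Pi.add_apply]
        have e1 : (⟨i'.succ, hlt⟩ : Fin (M + 1)) = i.succ := rfl
        rw [e1]
        by_cases h : r = i'.castSucc
        · have : (⟨r, hr⟩ : Fin (M + 1)) = i.castSucc := Fin.ext (show r.val = i.val from congrArg Fin.val h)
          rw [if_pos h, if_pos h, this, Pi.single_eq_same]
          ring
        · have : (⟨r, hr⟩ : Fin (M + 1)) ≠ i.castSucc := fun e =>
            h (Fin.ext (show r.val = i.val from congrArg Fin.val e))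
          rw [if_neg h, if_neg h, Pi.single_eq_of_ne this]
          ring
      · have h : r ≠ i'.castSucc := fun h => hr (h ▸ i.castSucc.isLt)
        rw [if_neg h, addCol_apply_of_le _ _ _ (not_lt.1 hr), addCol_apply_of_le _ _ _ (not_lt.1 hr),
          addRow_apply, if_neg h]
    · rw [addRow_apply, addCol_apply_of_ne _ _ _ _ hj, addCol_apply_of_ne _ _ _ _ hj,
        addCol_apply_of_ne _ _ _ _ hj, addRow_apply]

theorem colFourier_addRow (f : ColumnMatrix c → ℝ) (i : Fin M) (S : Fin (M + 1) → ZMod 2)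
    (A : ColumnMatrix c) :
    ∑ v, sgn (S ⬝ᵥ v) *
        f (addRow (Fin.castLE (le_of_val_eq_succ hM) i.castSucc) 1 (addCol j hM.ge v A)) =
      colFourier hM.ge f (shear i S)
        (addRow (Fin.castLE (le_of_val_eq_succ hM) i.castSucc) 1 A) := by
  rw [← Equiv.sum_comp (rowShear_involutive i).toPerm, colFourier]
  refine Finset.sum_congr rfl fun v _ => ?_
  rw [Function.Involutive.coe_toPerm, addRow_addCol hM, rowShear_involutive, dotProduct_rowShear]

/-- By strict monotonicity, the row of the leading one of column `j` vanishes in all earlier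
columns, so adding it only translates column `j` by a basis vector. -/
theorem DependsOnColumns.apply_addRow_last {f : ColumnMatrix c → ℝ}
    (hf : DependsOnColumns (j.val + 1) f) (hc : StrictMono c) (A : ColumnMatrix c) :
    f (addRow (Fin.castLE (le_of_val_eq_succ hM) (Fin.last M)) 1 A) =
      f (addCol j hM.ge (Pi.single (Fin.last M) 1) A) := by
  apply hf
  intro r j' hj'
  set i' := Fin.castLE (le_of_val_eq_succ hM) (Fin.last M) with hi'
  have hs : i'.succ = c j := Fin.ext hM.symm
  rw [addRow_apply, hs, one_mul, addCol_apply]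
  congr 1
  rcases Nat.lt_succ_iff_lt_or_eq.1 hj' with h | h
  · rw [A.2.1 _ _ (hc (Fin.lt_def.2 h)), ite_self, dif_neg fun e => h.ne (congrArg Fin.val e.1)]
  · obtain rfl : j' = j := Fin.ext h
    rw [A.2.2]
    by_cases hr : r = i'.castSucc
    · subst hr
      rw [if_pos rfl, dif_pos ⟨rfl, Nat.lt_succ_self M⟩]
      exact (Pi.single_eq_same (M := fun _ => ZMod 2) (Fin.last M) 1).symm
    · rw [if_neg hr]
      split_ifs with h2
      · rw [Pi.single_eq_of_ne]
        exact fun e => hr (Fin.ext (show r.val = M from congrArg Fin.val e))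
      · rfl

theorem DependsOnColumns.apply_addRow_of_le {d : ℕ} {f : ColumnMatrix c → ℝ}
    (hf : DependsOnColumns d f) {i : Fin m} (hi : ∀ j : Fin k, j.val < d → (c j).val ≤ i.val)
    (A : ColumnMatrix c) : f (addRow i 1 A) = f A := by
  apply hf
  intro r j' hj'
  have h : c j' < i.succ := Fin.lt_def.2 (Nat.lt_succ_of_le (hi j' hj'))
  rw [addRow_apply, A.2.1 _ _ h, mul_zero, ite_self, add_zero]

/-- The eigenvalue equation after a Fourier transform in the column `j`. -/
theorem colFourier_eigen {f : ColumnMatrix c → ℝ} (hf : DependsOnColumns (j.val + 1) f)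
    (hc : StrictMono c) {lam : ℝ} (heig : -(matrixWalkGenerator c f) = lam • f)
    (S : Fin (M + 1) → ZMod 2) (A : ColumnMatrix c) :
    ∑ i : Fin M, 1 / 2 * (colFourier hM.ge f S A - colFourier hM.ge f (shear i S)
        (addRow (Fin.castLE (le_of_val_eq_succ hM) i.castSucc) 1 A)) +
      1 / 2 * (1 - sgn (S (Fin.last M))) * colFourier hM.ge f S A =
    lam * colFourier hM.ge f S A := by
  have h1 : lam * colFourier hM.ge f S A = ∑ v, sgn (S ⬝ᵥ v) *
      ∑ i, 1 / 2 * (f (addCol j hM.ge v A) - f (addRow i 1 (addCol j hM.ge v A))) := by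
    rw [colFourier, Finset.mul_sum]
    refine Finset.sum_congr rfl fun v _ => ?_
    rw [← neg_matrixWalkGenerator_apply]
    have := congrFun heig (addCol j hM.ge v A)
    rw [Pi.neg_apply, Pi.smul_apply, smul_eq_mul] at this
    rw [this]
    ring
  have hle : ∀ i : Fin m, M + 1 ≤ i.val → ∀ j' : Fin k, j'.val < j.val + 1 →
      (c j').val ≤ i.val := fun i hi j' hj' =>
    (Fin.le_def.1 (hc.monotone (Fin.le_def.2 (Nat.lt_succ_iff.1 hj')))).trans (hM ▸ hi)
  have h2 : ∀ B, ∑ i, 1 / 2 * (f B - f (addRow i 1 B)) =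
      ∑ i : Fin M, 1 / 2 * (f B -
        f (addRow (Fin.castLE (le_of_val_eq_succ hM) i.castSucc) 1 B)) +
      1 / 2 * (f B - f (addCol j hM.ge (Pi.single (Fin.last M) 1) B)) := fun B => by
    rw [sum_castLE (le_of_val_eq_succ hM), Fin.sum_univ_castSucc, hf.apply_addRow_last hM hc]
    intro i hi
    rw [hf.apply_addRow_of_le (hle i hi), sub_self, mul_zero]
  -- Translation in the column becomes multiplication by a character value.
  have h3 : ∑ v, sgn (S ⬝ᵥ v) *
      f (addCol j hM.ge (Pi.single (Fin.last M) 1) (addCol j hM.ge v A)) =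
      sgn (S (Fin.last M)) * colFourier hM.ge f S A := by
    rw [colFourier, Finset.mul_sum, ← Equiv.sum_comp (Equiv.addLeft (Pi.single (Fin.last M) 1))]
    refine Finset.sum_congr rfl fun v _ => ?_
    rw [Equiv.coe_addLeft, addCol_add, ← add_assoc, CharTwo.add_self_eq_zero, zero_add,
      dotProduct_add, dotProduct_single_one, sgn_add, mul_assoc]
  rw [h1]
  simp only [h2, mul_add, Finset.sum_add_distrib, Finset.mul_sum]
  congr 1
  · rw [Finset.sum_comm]
    refine Finset.sum_congr rfl fun i _ => ?_
    rw [← colFourier_addRow hM, colFourier, ← Finset.sum_sub_distrib, Finset.mul_sum]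
    exact Finset.sum_congr rfl fun v _ => by ring
  · rw [mul_assoc, sub_mul, one_mul, ← h3]
    rw [colFourier, ← Finset.sum_sub_distrib, Finset.mul_sum]
    exact Finset.sum_congr rfl fun v _ => by ring

end

end

theorem shear_zero {N : ℕ} (i : Fin N) : shear i (0 : Fin (N + 1) → ZMod 2) = 0 := by
  simp [shear]

section
variable {m k : ℕ} {c : Fin k → Fin (m + 1)} {M : ℕ} {j : Fin k} (hM : (c j).val = M + 1)

/-- Shears fix the zero frequency and its killing rate is zero; the remaining row operations do not
affect a function of the earlier columns. -/
theorem colFourier_zero_eigen {f : ColumnMatrix c → ℝ} (hf : DependsOnColumns (j.val + 1) f)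
    (hc : StrictMono c) {lam : ℝ} (heig : -(matrixWalkGenerator c f) = lam • f) :
    -(matrixWalkGenerator c (colFourier hM.ge f 0)) = lam • colFourier hM.ge f 0 := by
  funext A
  have h := colFourier_eigen hM hf hc heig 0 A
  rw [Pi.zero_apply, sgn_zero, sub_self, mul_zero, zero_mul, add_zero] at h
  rw [Pi.neg_apply, neg_matrixWalkGenerator_apply, Pi.smul_apply, smul_eq_mul, ← h,
    sum_castLE ((Nat.le_succ M).trans (le_of_val_eq_succ hM))]
  · exact Finset.sum_congr rfl fun i _ => by rw [shear_zero]; rfl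
  · intro i hi
    rw [(hf.colFourier_zero hM).apply_addRow_of_le, sub_self, mul_zero]
    intro j' hj'
    have : (c j').val < (c j).val := hc (Fin.lt_def.2 hj')
    omega

/-! ### Energy bound for the norms of the Fourier coefficients -/

/-- The `ℓ²` norm of the Fourier transform in the column `j`, restricted to non-zero frequencies. -/
noncomputable def colFourierNorm (f : ColumnMatrix c → ℝ) (S : Fin (M + 1) → ZMod 2) : ℝ :=
  if S = 0 then 0 else √(∑ A, colFourier hM.ge f S A ^ 2)

theorem colFourierNorm_energy_le {f : ColumnMatrix c → ℝ} (hf : DependsOnColumns (j.val + 1) f)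
    (hc : StrictMono c) {lam : ℝ} (heig : -(matrixWalkGenerator c f) = lam • f)
    (S : Fin (M + 1) → ZMod 2) :
    ∑ i : Fin M, 1 / 2 * (colFourierNorm hM f S ^ 2 -
        colFourierNorm hM f S * colFourierNorm hM f (shear i S)) +
      1 / 2 * (1 - sgn (S (Fin.last M))) * colFourierNorm hM f S ^ 2 ≤
    lam * colFourierNorm hM f S ^ 2 := by
  by_cases hS : S = 0
  · simp [colFourierNorm, hS]
  have hF : colFourierNorm hM f S ^ 2 = ∑ A, colFourier hM.ge f S A ^ 2 := by
    rw [colFourierNorm, if_neg hS, Real.sq_sqrt (Finset.sum_nonneg fun A _ => sq_nonneg _)]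
  -- Cauchy-Schwarz removes the matrix variable: a row operation permutes the matrices and so
  -- preserves the `ℓ²` norm.
  have hCS : ∀ i : Fin M, ∑ A, colFourier hM.ge f S A * colFourier hM.ge f (shear i S)
      (addRow (Fin.castLE (le_of_val_eq_succ hM) i.castSucc) 1 A) ≤
      colFourierNorm hM f S * colFourierNorm hM f (shear i S) := fun i => by
    have hS' : shear i S ≠ 0 := fun h => hS (by rw [← shear_involutive i S, h, shear_zero])
    refine (Real.sum_mul_le_sqrt_mul_sqrt _ _ _).trans_eq ?_
    rw [colFourierNorm, colFourierNorm, if_neg hS, if_neg hS']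
    congr 2
    exact Equiv.sum_comp (addRow_one_involutive (c := c) _).toPerm
      fun A => colFourier hM.ge f (shear i S) A ^ 2
  have hE : ∑ A, colFourier hM.ge f S A * (∑ i : Fin M, 1 / 2 * (colFourier hM.ge f S A -
        colFourier hM.ge f (shear i S)
          (addRow (Fin.castLE (le_of_val_eq_succ hM) i.castSucc) 1 A)) +
      1 / 2 * (1 - sgn (S (Fin.last M))) * colFourier hM.ge f S A) =
      lam * colFourierNorm hM f S ^ 2 := by
    rw [hF, Finset.mul_sum]
    refine Finset.sum_congr rfl fun A _ => ?_
    rw [colFourier_eigen hM hf hc heig]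
    ring
  rw [← hE]
  simp only [mul_add, Finset.sum_add_distrib, Finset.mul_sum]
  rw [Finset.sum_comm]
  refine add_le_add (Finset.sum_le_sum fun i _ => ?_) (le_of_eq ?_)
  · have h1 : ∑ A, colFourier hM.ge f S A * (1 / 2 * (colFourier hM.ge f S A -
        colFourier hM.ge f (shear i S)
          (addRow (Fin.castLE (le_of_val_eq_succ hM) i.castSucc) 1 A))) =
        1 / 2 * (colFourierNorm hM f S ^ 2 - ∑ A, colFourier hM.ge f S A *
          colFourier hM.ge f (shear i S)
            (addRow (Fin.castLE (le_of_val_eq_succ hM) i.castSucc) 1 A)) := by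
      rw [hF, ← Finset.sum_sub_distrib, Finset.mul_sum]
      exact Finset.sum_congr rfl fun A _ => by ring
    rw [h1]
    linarith [hCS i]
  · rw [hF, Finset.mul_sum]
    exact Finset.sum_congr rfl fun A _ => by ring

end

/-! ### Induction on the columns and the theorem -/

section
variable {m k : ℕ} {c : Fin k → Fin (m + 1)}

/-- The constants in the Poincaré inequalities of the columns bound the non-trivial eigenvalues of
the matrix walk from below. -/
theorem le_eigenvalue_of_dependsOnColumns (hc : StrictMono c) {lam γ : ℝ} :
    ∀ (d : ℕ) (f : ColumnMatrix c → ℝ), DependsOnColumns d f → (∃ A B, f A ≠ f B) →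
      -(matrixWalkGenerator c f) = lam • f →
      (∀ j : Fin k, j.val < d → EastPoincare (c j).val γ) → γ ≤ lam := by
  intro d
  induction d with
  | zero =>
    rintro f hf ⟨A, B, hAB⟩
    exact absurd (hf A B fun _ _ h => absurd h (Nat.not_lt_zero _)) hAB
  | succ d ih =>
    intro f hf hne heig hP
    have hP' : ∀ j : Fin k, j.val < d → EastPoincare (c j).val γ := fun j hj =>
      hP j (hj.trans (Nat.lt_succ_self d))
    by_cases hd : d < k
    · obtain ⟨j, rfl⟩ : ∃ j : Fin k, d = j.val := ⟨⟨d, hd⟩, rfl⟩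
      rcases hM : (c j).val with _ | M
      -- A column whose leading one is in the top row is fully determined, so `f` already depends on
      -- the earlier columns only.
      · refine ih f (fun A B hAB => hf A B fun r j' hj' => ?_) hne heig hP'
        rcases Nat.lt_succ_iff_lt_or_eq.1 hj' with h | h
        · exact hAB r j' h
        · obtain rfl : j' = j := Fin.ext h
          rcases Nat.eq_zero_or_pos r.val with hr | hr
          · obtain rfl : r = c j' := Fin.ext (hr.trans hM.symm)
            rw [A.2.2, B.2.2]
          · have hr' : c j' < r := Fin.lt_def.2 (hM ▸ hr)
            rw [A.2.1 _ _ hr', B.2.1 _ _ hr']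
      · by_cases h0 : ∃ A B, colFourier hM.ge f 0 A ≠ colFourier hM.ge f 0 B
        · exact ih _ (hf.colFourier_zero hM) h0 (colFourier_zero_eigen hM hf hc heig) hP'
        · push Not at h0
          have hPM : EastPoincare (M + 1) γ := hM ▸ hP j (Nat.lt_succ_self _)
          have h1 := hPM.le_shear (colFourierNorm hM f) (if_pos rfl)
          have h2 := Finset.sum_le_sum fun S (_ : S ∈ Finset.univ) =>
            colFourierNorm_energy_le hM hf hc heig S
          rw [← Finset.mul_sum] at h2
          refine le_of_mul_le_mul_right (h1.trans h2) ?_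
          -- If all non-zero frequencies vanished, Fourier inversion would make `f` a multiple of
          -- its constant zero frequency.
          refine lt_of_le_of_ne (Finset.sum_nonneg fun S _ => sq_nonneg _) fun hz => ?_
          rw [eq_comm, Finset.sum_eq_zero_iff_of_nonneg fun S _ => sq_nonneg _] at hz
          have hzero : ∀ S ≠ 0, ∀ A, colFourier hM.ge f S A = 0 := fun S hS A => by
            have h := pow_eq_zero_iff (two_ne_zero) |>.1 (hz S (Finset.mem_univ S))
            rw [colFourierNorm, if_neg hS, Real.sqrt_eq_zero
              (Finset.sum_nonneg fun A _ => sq_nonneg _),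
              Finset.sum_eq_zero_iff_of_nonneg fun A _ => sq_nonneg _] at h
            exact pow_eq_zero_iff (two_ne_zero) |>.1 (h A (Finset.mem_univ A))
          have hinv : ∀ A, 2 ^ (M + 1) * f A = colFourier hM.ge f 0 A := fun A => by
            rw [← sum_colFourier hM.ge, Fintype.sum_eq_single 0 fun S hS => hzero S hS A]
          obtain ⟨A, B, hAB⟩ := hne
          refine hAB (mul_left_cancel₀ (pow_ne_zero (M + 1) (two_ne_zero' ℝ)) ?_)
          rw [hinv, hinv, h0 A B]
    · refine ih f (fun A B hAB => hf A B fun r j' _ => hAB r j' ?_) hne heig hP'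
      exact j'.isLt.trans_le (not_lt.1 hd)

end

theorem spectralGap_matrixWalk {m k : ℕ} {c : Fin (k + 1) → Fin (m + 1)} (hc : StrictMono c) :
    spectralGap (matrixWalkGenerator c) =
      spectralGap (eastGenerator (1 / 2) (c (Fin.last k)).val) := by
  refine le_antisymm (spectralGap_matrixWalk_le _) (le_iInf₂ fun lam h => ?_)
  obtain ⟨f, hne, heig⟩ := h
  have hf : DependsOnColumns (k + 1) f := fun A B h =>
    congrArg f (ColumnMatrix.ext' fun r j => h r j j.isLt)
  have hle : ∀ γ, EastPoincare (c (Fin.last k)).val γ → γ ≤ lam := fun γ hγ =>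
    le_eigenvalue_of_dependsOnColumns hc _ f hf hne heig fun j _ =>
      hγ.mono (hc.monotone (Fin.le_last j))
  by_cases hN : (c (Fin.last k)).val = 0
  -- On a one-point space every constant is admissible, and `lam + 1` contradicts the existence of
  -- the eigenvalue `lam`.
  · have hP : EastPoincare (c (Fin.last k)).val (lam + 1) := by
      rw [hN]
      intro G hG
      rw [Fintype.sum_unique] at hG
      simp [hG]
    linarith [hle _ hP]
  · obtain ⟨γ, hγ, hP⟩ := exists_east_gap hN
    exact (iInf₂_le γ hγ).trans (ENNReal.ofReal_le_ofReal (hle γ hP))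

/-- The matrices have `n = m + 1` rows. Since columns are numbered from `0`, the `j`-th chosen
column is `i_{j+1} = c j + 1`, and `i_k - 1` is the value of `c` at its last argument. -/
theorem mainTheorem1 :
    (∀ (m k : ℕ) (c : Fin (k + 1) → Fin (m + 1)), StrictMono c →
      relaxationTime (matrixWalkGenerator c) =
        relaxationTime (eastGenerator (1 / 2) (c (Fin.last k)).val)) ∧
    (∀ m : ℕ,
      relaxationTime (fullMatrixWalkGenerator m) = relaxationTime (eastGenerator (1 / 2) m) ∧
      spectralGap (fullMatrixWalkGenerator m) = spectralGap (eastGenerator (1 / 2) m)) := by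
  refine ⟨fun m k c hc => ?_, fun m => ?_⟩
  · rw [relaxationTime, relaxationTime, spectralGap_matrixWalk hc]
  · have h : spectralGap (fullMatrixWalkGenerator m) = spectralGap (eastGenerator (1 / 2) m) :=
      spectralGap_matrixWalk (c := id) strictMono_id
    exact ⟨by rw [relaxationTime, relaxationTime, h], h⟩
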